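/- Let $(S,+)$ be a commutative semigroup with the discrete topology, and let $\beta S$ be the set of all ultrafilters on $S$, with the operation given by $A\in p+q \iff \{x\in S:\{y\in S:x+y\in A\}\in q\}\in p$. For $A\subseteq S$ put $\operatorname{cl}A=\{p\in\beta S:A\in p\}$. For a set $X$, $\mathcal P_f(X)$ denotes the set of nonempty finite subsets of $X$. Let $\mathcal A$ be a family of subsets of $S$ and $T=\bigcap_{A\in\mathcal A}\operatorname{cl}A$; let $(D,\le)$ be a (nonempty) directed set, where $d<d'$ means $d\le d'$ and $d'\not\le d$, let $\mathcal P_f^{lin}(D)$ be the set of nonempty finite linearly ordered subsets of $D$, and let $\mathcal T$ be a set of functions from $D$ to $S$. Assume that (1) $\mathcal A\neq\emptyset$ and $\emptyset\notin\mathcal A$; (2) $A\cap B\in\mathcal A$ for all $A,B\in\mathcal A$; (3) for all $A\in\mathcal A$ and $a\in A$ there is $B\in\mathcal A$ with $a+B\subseteq A$; (4) for all $A\in\mathcal A$, $d\in D$ and $F\in\mathcal P_f(\mathcal T)$ there is $d'\in D$ with $d<d'$ and $f(d')\in A$ for all $f\in F$. Let $p=p+p$ be an idempotent in $K(T)$,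 the smallest two-sided ideal of the semigroup $T$, let $(C_n)_{n=1}^\infty$ be a sequence of subsets of $S$ with $C_n\in p$ for every $n\ge 1$, and let $\Phi:\mathcal P_f(\mathcal T)\to\mathcal A$. Then there exist functions $\alpha:\mathcal P_f(\mathcal T)\to C_1$ and $H:\mathcal P_f(\mathcal T)\to\mathcal P_f^{lin}(D)$ such that (a) $\alpha(F)\in\Phi(F)$ for all $F\in\mathcal P_f(\mathcal T)$; (b) $\alpha(F)+\sum_{t\in H(F)}f(t)\in C_1\cap\Phi(F)$ for all $F\in\mathcal P_f(\mathcal T)$ and $f\in F$; (c) if $F,G\in\mathcal P_f(\mathcal T)$ and $G\subsetneq F$, then $\max H(G)<\min H(F)$; (d) if $m\ge 1$, $G_1\subsetneq G_2\subsetneq\dots\subsetneq G_m$ are in $\mathcal P_f(\mathcal T)$, and $f_i\in G_i$ for $i=1,\dots,m$, then $$\sum_{i=1}^m\Bigl(\alpha(G_i)+\sum_{t\in H(G_i)}f_i(t)\Bigr)\in C_{|G_1|}.$$ -/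

import Mathlib

/- The addition on `Ultrafilter S` that extends the addition of `S`:
`A ∈ p + q` if and only if `{x | {y | x + y ∈ A} ∈ q} ∈ p`. -/
attribute [local instance] Ultrafilter.add

/-- `βcl A` is the set of all ultrafilters on `S` that contain `A`, which is the closure of `A`
in the Stone–Čech compactification of the discrete space `S`. -/
def βcl {S : Type*} (A : Set S) : Set (Ultrafilter S) := {p | A ∈ p}

/-- `I` is a (nonempty, two-sided) ideal of the semigroup `T`, where `T` is given as a subset of
a type with an addition. -/
structure IsIdealIn {X : Type*} [Add X] (T I : Set X) : Prop where
  nonempty : I.Nonempty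
  subset : I ⊆ T
  add_left : ∀ t ∈ T, ∀ x ∈ I, t + x ∈ I
  add_right : ∀ t ∈ T, ∀ x ∈ I, x + t ∈ I

/-- The smallest ideal `K(T)` of `T`: the intersection of all ideals of `T`. -/
def smallestIdeal {X : Type*} [Add X] (T : Set X) : Set X := {x | ∀ I, IsIdealIn T I → x ∈ I}

/-- The type of nonempty finite subsets of the set `A`. -/
abbrev Pf {X : Type*} (A : Set X) : Type _ := {F : Finset X // F.Nonempty ∧ (F : Set X) ⊆ A}

/-- The type of nonempty finite linearly ordered subsets of `D`. -/
abbrev PfLin (D : Type*) [Preorder D] : Type _ :=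
  {H : Finset D // H.Nonempty ∧ IsChain (· < ·) (H : Set D)}

/-- For `C ⊆ S`, the same set seen in `WithZero S`, the semigroup `S` with an additional zero
element adjoined. Sums over finite sets are formed in `WithZero S`, because `S` itself need not
have a zero; `x ∈ inS C` says that `x` is an element of `S` and belongs to `C`. -/
def inS {S : Type*} (C : Set S) : Set (WithZero S) := (fun s : S => (s : WithZero S)) '' C

/-!
Write `T = ⋂ A ∈ 𝒜, cl A`; it is a nonempty closed subsemigroup of `βS`.

*Piecewise syndeticity.* Every `p ∈ K(T)` satisfies `p ∈ T + q + p` for all `q ∈ T`, because the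
elements with this property form an ideal containing each minimal left ideal. By compactness, for
every `A ∈ p` there are `Ψ ∈ 𝒜` and a finite set `X` such that each `z ∈ Ψ` has an `x ∈ X` with
`{y | x + z + y ∈ A} ∈ p` (`exists_finset_cover_of_mem_smallestIdeal`).

*One step.* Fix `A ∈ p`, a finite `F ⊆ 𝒯` and `d ∈ D`. Hypotheses `h3` and `h4` yield arbitrarily long
chains `d < δ₁ < ⋯ < δ_N` such that, for every word `w` whose letters are elements of `F` or a blank
letter, `c + ∑ w_i(δ_i)` lies in `Ψ`. Colour each word by an `x ∈ X` that serves its sum. The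
Hales–Jewett theorem gives a monochromatic line. Since the finitely many sets in `p` belonging to
its points have a common element `y`, all the sums `x + (c + ∑ w_i(δ_i)) + y` along the line lie in
`A`. The blank letter gives an element `a ∈ A`, the letter `f` gives `a + ∑ t ∈ H, f t`, where `H`
consists of the `δ_i` at the moving coordinates (`exists_add_sum_mem`). Using Hales–Jewett in
this way avoids the smallest ideals of product semigroups.

*Recursion.* As `p` is idempotent, `starSet p C` is in `p` whenever `C` is, and so is each of its
translates `-x + starSet p C` with `x ∈ starSet p C`. The functions `α` and `H` are built by recursion on `F` along
strict inclusion: the step is applied beyond all earlier `H(G)`, to a set `A ∈ p` which ensures that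
all sums along chains `G₁ ⊂ ⋯ ⊂ G_m ⊂ F` stay in `starSet p (C |G₁|)`. These sums are recorded in a
finite set as part of the recursion (`ChainData`).
-/

/-! ### The subsemigroup `T` and its smallest ideal -/

open Filter in
/-- If `𝒜` is closed under intersections and no member of `𝒜` is contained in `Z`, then some
ultrafilter contains all members of `𝒜` but not `Z`. This is where compactness of `βS` enters. -/
theorem exists_mem_iInter_βcl_notMem {S : Type*} {𝒜 : Set (Set S)} (hne : 𝒜.Nonempty)
    (hinter : ∀ A ∈ 𝒜, ∀ B ∈ 𝒜, A ∩ B ∈ 𝒜) {Z : Set S} (hZ : ∀ A ∈ 𝒜, ¬ A ⊆ Z) :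
    ∃ q ∈ ⋂ A ∈ 𝒜, βcl A, Z ∉ q := by
  let b : FilterBasis S :=
    { sets := 𝒜
      nonempty := hne
      inter_sets := fun hA hB => ⟨_, hinter _ hA _ hB, subset_rfl⟩ }
  have hb : (b.filter ⊓ 𝓟 Zᶜ).NeBot := by
    rw [b.hasBasis.inf_principal_neBot_iff]
    intro A hA
    obtain ⟨x, hxA, hxZ⟩ := Set.not_subset.1 (hZ A hA)
    exact ⟨x, hxA, hxZ⟩
  refine ⟨Ultrafilter.of (b.filter ⊓ 𝓟 Zᶜ), ?_, ?_⟩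
  · simp only [Set.mem_iInter]
    exact fun A hA => Ultrafilter.of_le _ (mem_inf_of_left (b.mem_filter_of_mem hA))
  · rw [← Ultrafilter.compl_mem_iff_notMem]
    exact Ultrafilter.of_le _ (mem_inf_of_right (mem_principal_self _))

theorem Ultrafilter.add_assoc' {S : Type*} [AddSemigroup S] (p q r : Ultrafilter S) :
    p + q + r = p + (q + r) :=
  Ultrafilter.addSemigroup.add_assoc p q r

theorem mem_ultrafilter_add {S : Type*} [Add S] {p q : Ultrafilter S} {A : Set S} :
    A ∈ p + q ↔ {x | {y | x + y ∈ A} ∈ q} ∈ p :=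
  Iff.rfl

theorem add_mem_iInter_βcl {S : Type*} [Add S] {𝒜 : Set (Set S)}
    (hshift : ∀ A ∈ 𝒜, ∀ a ∈ A, ∃ B ∈ 𝒜, ∀ b ∈ B, a + b ∈ A) {p q : Ultrafilter S}
    (hp : p ∈ ⋂ A ∈ 𝒜, βcl A) (hq : q ∈ ⋂ A ∈ 𝒜, βcl A) : p + q ∈ ⋂ A ∈ 𝒜, βcl A := by
  simp only [Set.mem_iInter] at *
  intro A hA
  refine mem_ultrafilter_add.2 (Filter.mem_of_superset (hp A hA) fun a ha => ?_)
  obtain ⟨B, hB, hBA⟩ := hshift A hA a ha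
  exact Filter.mem_of_superset (hq B hB) hBA

theorem isClosed_iInter_βcl {S : Type*} (𝒜 : Set (Set S)) : IsClosed (⋂ A ∈ 𝒜, βcl A) :=
  isClosed_biInter fun A _ => ultrafilter_isClosed_basic A

/-- A nonempty closed subset `L` of `T` with `T + L ⊆ L`, that is, a closed left ideal of `T`. -/
structure IsClosedLeftIdealIn {X : Type*} [Add X] [TopologicalSpace X] (T L : Set X) : Prop where
  nonempty : L.Nonempty
  isClosed : IsClosed L
  subset : L ⊆ T
  add_left : ∀ t ∈ T, ∀ x ∈ L, t + x ∈ L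

theorem exists_minimal_isClosedLeftIdealIn {X : Type*} [Add X] [TopologicalSpace X]
    [CompactSpace X] {T : Set X} (hne : T.Nonempty) (hcl : IsClosed T)
    (hadd : ∀ s ∈ T, ∀ t ∈ T, s + t ∈ T) : ∃ L, Minimal (IsClosedLeftIdealIn T) L := by
  refine (zorn_superset_nonempty {L | IsClosedLeftIdealIn T L} (fun c hc hchain hcne => ?_)
    T ⟨hne, hcl, subset_rfl, fun t ht x hx => hadd t ht x hx⟩).imp fun L hL => hL.2
  refine ⟨⋂₀ c, ⟨?_, isClosed_sInter fun L hL => (hc hL).isClosed, ?_, ?_⟩,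
    fun L hL => Set.sInter_subset_of_mem hL⟩
  · have := hcne.to_subtype
    exact IsCompact.nonempty_sInter_of_directed_nonempty_isCompact_isClosed
      (IsChain.directedOn hchain.symm) (fun L hL => (hc hL).nonempty)
      (fun L hL => (hc hL).isClosed.isCompact) (fun L hL => (hc hL).isClosed)
  · obtain ⟨L, hL⟩ := hcne
    exact (Set.sInter_subset_of_mem hL).trans (hc hL).subset
  · exact fun t ht x hx L hL => (hc hL).add_left t ht x (hx L hL)

/-- Every element `p` of the smallest ideal of `T` lies in `T + q + p` for each `q ∈ T`. The set of
elements with this property is an ideal as soon as it is nonempty, and it contains every minimal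
left ideal. -/
theorem exists_eq_add_add_of_mem_smallestIdeal {S : Type*} [AddSemigroup S]
    {T : Set (Ultrafilter S)} (hne : T.Nonempty) (hcl : IsClosed T)
    (hadd : ∀ s ∈ T, ∀ t ∈ T, s + t ∈ T) {p : Ultrafilter S} (hp : p ∈ smallestIdeal T)
    {q : Ultrafilter S} (hq : q ∈ T) : ∃ r ∈ T, r + (q + p) = p := by
  have key : IsIdealIn T {x | x ∈ T ∧ ∀ q ∈ T, ∃ r ∈ T, r + (q + x) = x} := by
    refine ⟨?_, fun x hx => hx.1, ?_, ?_⟩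
    · obtain ⟨L, hL⟩ := exists_minimal_isClosedLeftIdealIn hne hcl hadd
      obtain ⟨x, hx⟩ := hL.prop.nonempty
      refine ⟨x, hL.prop.subset hx, fun q hq => ?_⟩
      have hqx : q + x ∈ L := hL.prop.add_left q hq x hx
      have hsub : (· + (q + x)) '' T ⊆ L := by
        rintro _ ⟨r, hr, rfl⟩
        exact hL.prop.add_left r hr _ hqx
      have hI : IsClosedLeftIdealIn T ((· + (q + x)) '' T) := by
        refine ⟨hne.image _, (Ultrafilter.continuous_add_left _).isClosedMap _ hcl,
          hsub.trans hL.prop.subset, ?_⟩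
        rintro t ht _ ⟨r, hr, rfl⟩
        exact ⟨t + r, hadd t ht r hr, Ultrafilter.add_assoc' _ _ _⟩
      exact hL.le_of_le hI hsub hx
    · rintro t ht x ⟨hxT, hx⟩
      refine ⟨hadd t ht x hxT, fun q hq => ?_⟩
      obtain ⟨r, hr, hrx⟩ := hx (q + t) (hadd q hq t ht)
      refine ⟨t + r, hadd t ht r hr, ?_⟩
      rw [Ultrafilter.add_assoc', ← Ultrafilter.add_assoc' q, hrx]
    · rintro t ht x ⟨hxT, hx⟩
      refine ⟨hadd x hxT t ht, fun q hq => ?_⟩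
      obtain ⟨r, hr, hrx⟩ := hx q hq
      refine ⟨r, hr, ?_⟩
      rw [← Ultrafilter.add_assoc' q, ← Ultrafilter.add_assoc' r, hrx]
  exact (hp _ key).2 q hq

/-- A member `A` of an ultrafilter of the smallest ideal of `T` is piecewise syndetic relative to
`𝒜`: for `B = {w | {y | w + y ∈ A} ∈ p}`, finitely many of the sets `{z | x + z ∈ B}` cover a
member of `𝒜`. -/
theorem exists_finset_cover_of_mem_smallestIdeal {S : Type*} [AddCommSemigroup S]
    {𝒜 : Set (Set S)} (h1 : 𝒜.Nonempty ∧ ∅ ∉ 𝒜) (h2 : ∀ A ∈ 𝒜, ∀ B ∈ 𝒜, A ∩ B ∈ 𝒜)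
    (h3 : ∀ A ∈ 𝒜, ∀ a ∈ A, ∃ B ∈ 𝒜, ∀ b ∈ B, a + b ∈ A)
    {p : Ultrafilter S} (hp : p ∈ smallestIdeal (⋂ A ∈ 𝒜, βcl A)) {A : Set S} (hA : A ∈ p) :
    ∃ Ψ ∈ 𝒜, ∃ X : Finset S, ∀ z ∈ Ψ, ∃ x ∈ X, {y | x + z + y ∈ A} ∈ p := by
  by_contra! hcon
  -- The sets `Ψ ∩ bad X` are nonempty and closed under intersection, so some `q ∈ T` contains none
  -- of the sets `{z | {y | x + z + y ∈ A} ∈ p}`; this contradicts `p ∈ T + q + p`.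
  let bad : Finset S → Set S := fun X => {z | ∀ x ∈ X, {y | x + z + y ∈ A} ∉ p}
  let ℬ : Set (Set S) := {B | ∃ Ψ ∈ 𝒜, ∃ X : Finset S, B = Ψ ∩ bad X}
  classical
  have hTne : (⋂ A ∈ 𝒜, βcl A).Nonempty := by
    obtain ⟨q, hq, -⟩ := exists_mem_iInter_βcl_notMem h1.1 h2 (Z := ∅)
      (fun A hA h => h1.2 (Set.subset_empty_iff.1 h ▸ hA))
    exact ⟨q, hq⟩
  obtain ⟨q, hq, -⟩ := exists_mem_iInter_βcl_notMem (𝒜 := ℬ) (Z := ∅)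
    (h1.1.elim fun Ψ hΨ => ⟨_, Ψ, hΨ, ∅, rfl⟩) (by
      rintro _ ⟨Ψ, hΨ, X, rfl⟩ _ ⟨Ψ', hΨ', X', rfl⟩
      refine ⟨Ψ ∩ Ψ', h2 _ hΨ _ hΨ', X ∪ X', ?_⟩
      ext z
      simp only [bad, Set.mem_inter_iff, Set.mem_ofPred_eq, Finset.mem_union, or_imp, forall_and]
      tauto) (by
      rintro _ ⟨Ψ, hΨ, X, rfl⟩ h
      obtain ⟨z, hz, hzX⟩ := hcon Ψ hΨ X
      exact h ⟨hz, hzX⟩)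
  simp only [Set.mem_iInter] at hq
  have hqT : q ∈ ⋂ A ∈ 𝒜, βcl A := by
    simp only [Set.mem_iInter]
    exact fun Ψ hΨ => Filter.mem_of_superset (hq _ ⟨Ψ, hΨ, ∅, rfl⟩) Set.inter_subset_left
  obtain ⟨Ψ₀, hΨ₀⟩ := h1.1
  obtain ⟨r, -, hr⟩ := exists_eq_add_add_of_mem_smallestIdeal hTne (isClosed_iInter_βcl 𝒜)
    (fun s hs t ht => add_mem_iInter_βcl h3 hs ht) hp hqT
  rw [← hr] at hA
  obtain ⟨x, hx⟩ := Ultrafilter.nonempty_of_mem (mem_ultrafilter_add.1 hA)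
  have hx' : {z | {y | x + (z + y) ∈ A} ∈ p} ∈ q := mem_ultrafilter_add.1 hx
  obtain ⟨z, hz, -, hzX⟩ := Ultrafilter.nonempty_of_mem
    (Filter.inter_mem hx' (hq _ ⟨Ψ₀, hΨ₀, {x}, rfl⟩))
  refine hzX x (Finset.mem_singleton_self x) ?_
  simp only [add_assoc]
  exact hz

/-! ### Monochromatic lines of words -/

theorem coe_mem_inS {S : Type*} {C : Set S} {s : S} : (s : WithZero S) ∈ inS C ↔ s ∈ C :=
  ⟨fun ⟨_, ht, h⟩ => WithZero.coe_inj.1 h ▸ ht, fun h => ⟨s, h, rfl⟩⟩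

theorem inS_mono {S : Type*} {A B : Set S} (h : A ⊆ B) : inS A ⊆ inS B :=
  Set.image_mono h

/-- The value of `f` at `t` for a letter `some f`, and zero for the blank letter `none`. -/
def letterValue {S D : Type*} (F : Finset (D → S)) (o : Option F) (t : D) : WithZero S :=
  o.elim 0 fun f => (f.1 t : WithZero S)

/-- There are arbitrarily long increasing sequences `δ` beyond `d` such that all sums of values
of words along `δ`, with letters in `F` or blank, lead from `c` into `Ψ`. -/
theorem exists_strictMono_word_sum_mem {S D : Type*} [AddCommSemigroup S] [Preorder D]
    [IsDirectedOrder D] [Nonempty D] {𝒜 : Set (Set S)} (h1 : 𝒜.Nonempty)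
    (h2 : ∀ A ∈ 𝒜, ∀ B ∈ 𝒜, A ∩ B ∈ 𝒜)
    (h3 : ∀ A ∈ 𝒜, ∀ a ∈ A, ∃ B ∈ 𝒜, ∀ b ∈ B, a + b ∈ A) (F : Finset (D → S))
    (hF : ∀ A ∈ 𝒜, ∀ d : D, ∃ d', d < d' ∧ ∀ f ∈ F, f d' ∈ A)
    {Ψ : Set S} (hΨ : Ψ ∈ 𝒜) {c : S} (hc : c ∈ Ψ) (d : D) (N : ℕ) :
    ∃ δ : Fin N → D, StrictMono δ ∧ (∀ i, d < δ i) ∧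
      ∀ w : Fin N → Option F, (c : WithZero S) + ∑ i, letterValue F (w i) (δ i) ∈ inS Ψ := by
  classical
  have hfin : ∀ s : Finset S, (↑s : Set S) ⊆ Ψ → ∃ B ∈ 𝒜, ∀ a ∈ s, ∀ b ∈ B, a + b ∈ Ψ := by
    intro s
    induction s using Finset.induction_on with
    | empty => exact fun _ => h1.imp fun B hB => ⟨hB, by simp⟩
    | insert a s _ ih =>
      intro hs
      rw [Finset.coe_insert, Set.insert_subset_iff] at hs
      obtain ⟨B, hB, hBs⟩ := ih hs.2
      obtain ⟨B', hB', hBa⟩ := h3 Ψ hΨ a hs.1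
      refine ⟨B ∩ B', h2 B hB B' hB', fun x hx b hb => ?_⟩
      obtain rfl | hx := Finset.mem_insert.1 hx
      exacts [hBa b hb.2, hBs x hx b hb.1]
  induction N with
  | zero => exact ⟨Fin.elim0, fun i => i.elim0, fun i => i.elim0, fun w => by simpa [coe_mem_inS]⟩
  | succ N ih =>
    obtain ⟨δ, hmono, hd, hw⟩ := ih
    choose v hvΨ hv using hw
    obtain ⟨B, hB, hBv⟩ := hfin (Finset.univ.image v) (by
      intro x hx
      obtain ⟨w, -, rfl⟩ := Finset.mem_image.1 (Finset.mem_coe.1 hx)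
      exact hvΨ w)
    obtain ⟨e, he⟩ := (insert d (Finset.univ.image δ)).exists_le
    obtain ⟨d', hed, hd'⟩ := hF B hB e
    have hlt : ∀ i, δ i < d' := fun i => (he _ (by simp)).trans_lt hed
    refine ⟨Fin.snoc δ d', ?_, ?_, fun w => ?_⟩
    · intro i j hij
      induction j using Fin.lastCases with
      | last =>
        obtain ⟨i, rfl⟩ := Fin.exists_castSucc_eq.2 hij.ne
        simpa using hlt i
      | cast j =>
        obtain ⟨i, rfl⟩ := Fin.exists_castSucc_eq.2 (hij.trans (Fin.castSucc_lt_last j)).ne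
        simpa using hmono (Fin.castSucc_lt_castSucc_iff.1 hij)
    · intro i
      induction i using Fin.lastCases with
      | last => simpa using (he d (by simp)).trans_lt hed
      | cast i => simpa using hd i
    · rw [Fin.sum_univ_castSucc, ← add_assoc]
      simp only [Fin.snoc_castSucc, Fin.snoc_last]
      rw [← hv fun i => w i.castSucc]
      cases h : w (Fin.last N) with
      | none => simpa [letterValue, coe_mem_inS] using hvΨ _
      | some f =>
        change ((_ : S) : WithZero S) + ((f.1 d' : S) : WithZero S) ∈ _
        rw [← WithZero.coe_add, coe_mem_inS]
        exact hBv _ (by simp) _ (hd' _ f.2)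

/-- One step of the construction: a member `A` of `p` contains some `a` together with all the sums
`a + ∑ t ∈ H, f t` for `f ∈ F`, where the chain `H` lies beyond a given `d`. -/
theorem exists_add_sum_mem {S D : Type*} [AddCommSemigroup S] [Preorder D]
    [IsDirectedOrder D] [Nonempty D] {𝒜 : Set (Set S)} (h1 : 𝒜.Nonempty ∧ ∅ ∉ 𝒜)
    (h2 : ∀ A ∈ 𝒜, ∀ B ∈ 𝒜, A ∩ B ∈ 𝒜)
    (h3 : ∀ A ∈ 𝒜, ∀ a ∈ A, ∃ B ∈ 𝒜, ∀ b ∈ B, a + b ∈ A) (F : Finset (D → S))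
    (hF : ∀ A ∈ 𝒜, ∀ d : D, ∃ d', d < d' ∧ ∀ f ∈ F, f d' ∈ A)
    {p : Ultrafilter S} (hp : p ∈ smallestIdeal (⋂ A ∈ 𝒜, βcl A)) {A : Set S} (hA : A ∈ p)
    (d : D) :
    ∃ a ∈ A, ∃ H : PfLin D, (∀ t ∈ H.1, d < t) ∧
      ∀ f ∈ F, (a : WithZero S) + ∑ t ∈ H.1, (f t : WithZero S) ∈ inS A := by
  classical
  obtain ⟨Ψ, hΨ, X, hX⟩ := exists_finset_cover_of_mem_smallestIdeal h1 h2 h3 hp hA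
  obtain ⟨c, hc⟩ : Ψ.Nonempty := Set.nonempty_iff_ne_empty.2 fun h => h1.2 (h ▸ hΨ)
  -- Colour a word by an `x ∈ X` such that the translate belonging to `x` contains its sum.
  obtain ⟨N, hN⟩ : ∃ N : ℕ, ∀ C : (Fin N → Option F) → X,
      ∃ l : Combinatorics.Line (Option F) (Fin N), l.IsMono C := by
    obtain ⟨ι, _, hι⟩ := Combinatorics.Line.exists_mono_in_high_dimension (Option F) X
    refine ⟨Fintype.card ι, fun C => ?_⟩
    let e := Fintype.equivFin ι
    obtain ⟨l, x, hl⟩ := hι fun w => C (w ∘ e.symm)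
    exact ⟨⟨l.idxFun ∘ e.symm, e l.proper.choose, by simpa using l.proper.choose_spec⟩, x, hl⟩
  obtain ⟨δ, hδ, hdδ, hsum⟩ := exists_strictMono_word_sum_mem h1.1 h2 h3 F hF hΨ hc d N
  choose v hvΨ hv using hsum
  beta_reduce at hv
  choose x hxX hx using fun w => hX (v w) (hvΨ w)
  obtain ⟨l, x₀, hl⟩ := hN fun w => ⟨x w, hxX w⟩
  have hmem : ∀ o, {y | x₀.1 + v (l o) + y ∈ A} ∈ p := by
    intro o
    have := hx (l o)
    rwa [show x (l o) = x₀.1 from congrArg Subtype.val (hl o)] at this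
  obtain ⟨y, hy⟩ := Ultrafilter.nonempty_of_mem (Filter.iInter_mem.2 hmem)
  rw [Set.mem_iInter] at hy
  -- The moving coordinates of the line form `H`; the blank letter yields `a`.
  let J : Finset (Fin N) := Finset.univ.filter fun i => l.idxFun i = none
  have hJ : J.Nonempty := l.proper.imp fun i hi => by simpa [J] using hi
  refine ⟨x₀.1 + v (l none) + y, hy none, ⟨J.map ⟨δ, hδ.injective⟩, hJ.map, ?_⟩, ?_, ?_⟩
  · intro s hs t ht hst
    obtain ⟨i, -, rfl⟩ := Finset.mem_map.1 (Finset.mem_coe.1 hs)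
    obtain ⟨j, -, rfl⟩ := Finset.mem_map.1 (Finset.mem_coe.1 ht)
    obtain h | h := lt_or_gt_of_ne (fun h : i = j => hst (h ▸ rfl))
    exacts [.inl (hδ h), .inr (hδ h)]
  · intro t ht
    obtain ⟨i, -, rfl⟩ := Finset.mem_map.1 ht
    exact hdδ i
  · intro f hf
    have hsplit : ∑ i, letterValue F (l (some ⟨f, hf⟩) i) (δ i) =
        ∑ i, letterValue F (l none i) (δ i) + ∑ i ∈ J, (f (δ i) : WithZero S) := by
      rw [Finset.sum_filter, ← Finset.sum_add_distrib]
      refine Finset.sum_congr rfl fun i _ => ?_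
      rw [Combinatorics.Line.coe_apply, Combinatorics.Line.coe_apply]
      cases h : l.idxFun i <;> simp [letterValue]
    have hval : (v (l (some ⟨f, hf⟩)) : WithZero S) =
        v (l none) + ∑ i ∈ J, (f (δ i) : WithZero S) := by
      rw [hv, hv, hsplit, add_assoc]
    rw [Finset.sum_map]
    simp only [Function.Embedding.coeFn_mk, WithZero.coe_add]
    rw [add_right_comm, add_assoc (x₀.1 : WithZero S), ← hval, ← WithZero.coe_add,
      ← WithZero.coe_add, coe_mem_inS]
    exact hy _

/-! ### Recursion along strict inclusion -/

theorem exists_forall_of_wellFounded {ι X : Type*} {r : ι → ι → Prop} (hr : WellFounded r)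
    (Q : ∀ i, (∀ j, r j i → X) → X → Prop) (h : ∀ i y, ∃ x, Q i y x) :
    ∃ f : ι → X, ∀ i, Q i (fun j _ => f j) (f i) := by
  choose g hg using h
  refine ⟨hr.fix g, fun i => ?_⟩
  have := hg i fun j _ => hr.fix g j
  rwa [← hr.fix_eq g i] at this

/-- The set `A⋆` of those `x ∈ A` for which `-x + A = {y | x + y ∈ A}` belongs to `p`. -/
def starSet {S : Type*} [Add S] (p : Ultrafilter S) (A : Set S) : Set S :=
  {x ∈ A | {y | x + y ∈ A} ∈ p}

theorem starSet_mem {S : Type*} [Add S] {p : Ultrafilter S} (hp : p + p = p) {A : Set S}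
    (hA : A ∈ p) : starSet p A ∈ p :=
  Filter.inter_mem hA (mem_ultrafilter_add.1 (hp.symm ▸ hA))

theorem add_starSet_mem {S : Type*} [AddSemigroup S] {p : Ultrafilter S} (hp : p + p = p)
    {A : Set S} {x : S} (hx : x ∈ starSet p A) : {y | x + y ∈ starSet p A} ∈ p := by
  have h : {y | {z | x + (y + z) ∈ A} ∈ p} ∈ p := by
    have := hx.2
    rw [← hp] at this
    exact mem_ultrafilter_add.1 this
  filter_upwards [hx.2, h] with y hy hy'
  refine ⟨hy, ?_⟩
  simpa only [add_assoc] using hy'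

theorem exists_isGreatest_of_isChain_lt {D : Type*} [Preorder D] {H : Finset D} (hne : H.Nonempty)
    (hH : IsChain (· < ·) (H : Set D)) : ∃ a, IsGreatest (H : Set D) a := by
  obtain ⟨a, ha⟩ := H.exists_maximal hne
  refine ⟨a, ha.prop, fun b hb => ?_⟩
  obtain rfl | hab := eq_or_ne b a
  · exact le_rfl
  · obtain h | h := hH hb ha.prop hab
    exacts [h.le, ha.le_of_ge hb h.le]

theorem exists_isLeast_of_isChain_lt {D : Type*} [Preorder D] {H : Finset D} (hne : H.Nonempty)
    (hH : IsChain (· < ·) (H : Set D)) : ∃ a, IsLeast (H : Set D) a :=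
  exists_isGreatest_of_isChain_lt (D := Dᵒᵈ) hne hH.symm

/-- The sum `a + ∑ t ∈ H, f t` attached to `f` by a pair `(a, H)`. -/
def blockSum {S D : Type*} [AddCommSemigroup S] [Preorder D] (a : S) (H : PfLin D) (f : D → S) :
    WithZero S :=
  (a : WithZero S) + ∑ t ∈ H.1, (f t : WithZero S)

/-- The value of the recursive construction at a set `F`: the element `a`, which stands for `α(F)`,
the chain `H`, which stands for `H(F)`, and a finite set `W` that records the pairs `(k, s)` where
`s` is one of the sums along the chains `G₁ ⊂ ⋯ ⊂ F` with `|G₁| = k`. The last field is the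
invariant that allows the sums to be continued. -/
structure ChainData {S D : Type*} [AddCommSemigroup S] [Preorder D] (p : Ultrafilter S)
    (C : ℕ → Set S) where
  a : S
  H : PfLin D
  W : Finset (ℕ × WithZero S)
  mem_starSet : ∀ w ∈ W, 1 ≤ w.1 ∧ w.2 ∈ inS (starSet p (C w.1))

theorem theorem17 {S : Type*} [AddCommSemigroup S]
    {D : Type*} [Preorder D] [IsDirectedOrder D] [Nonempty D]
    (𝒜 : Set (Set S)) (𝒯 : Set (D → S))
    (h1 : 𝒜.Nonempty ∧ ∅ ∉ 𝒜)
    (h2 : ∀ A ∈ 𝒜, ∀ B ∈ 𝒜, A ∩ B ∈ 𝒜)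
    (h3 : ∀ A ∈ 𝒜, ∀ a ∈ A, ∃ B ∈ 𝒜, ∀ b ∈ B, a + b ∈ A)
    (h4 : ∀ A ∈ 𝒜, ∀ d : D, ∀ F : Pf 𝒯, ∃ d' : D, d < d' ∧ ∀ f ∈ F.1, f d' ∈ A)
    (p : Ultrafilter S) (hp_idem : p + p = p)
    (hpK : p ∈ smallestIdeal (⋂ A ∈ 𝒜, βcl A))
    (C : ℕ → Set S) (hC : ∀ n, 1 ≤ n → p ∈ βcl (C n))
    (Φ : Pf 𝒯 → 𝒜) :
    ∃ (α : Pf 𝒯 → C 1) (H : Pf 𝒯 → PfLin D),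
      (∀ F : Pf 𝒯, (α F : S) ∈ (Φ F : Set S)) ∧
      (∀ F : Pf 𝒯, ∀ f ∈ F.1,
        ((α F : S) : WithZero S) + ∑ t ∈ (H F).1, (f t : WithZero S)
          ∈ inS (C 1 ∩ (Φ F : Set S))) ∧
      (∀ F G : Pf 𝒯, G.1 ⊂ F.1 →
        ∃ a b : D, IsGreatest ((H G).1 : Set D) a ∧ IsLeast ((H F).1 : Set D) b ∧ a < b) ∧
      (∀ (m : ℕ) (hm : 0 < m) (G : Fin m → Pf 𝒯) (f : Fin m → D → S),
        (∀ i j : Fin m, i < j → (G i).1 ⊂ (G j).1) →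
        (∀ i : Fin m, f i ∈ (G i).1) →
        ∑ i : Fin m, (((α (G i) : S) : WithZero S) + ∑ t ∈ (H (G i)).1, (f i t : WithZero S))
          ∈ inS (C (G ⟨0, hm⟩).1.card)) := by
  classical
  have hpT : p ∈ ⋂ A ∈ 𝒜, βcl A := by
    refine hpK _ ⟨?_, subset_rfl, fun s hs t ht => add_mem_iInter_βcl h3 hs ht,
      fun s hs t ht => add_mem_iInter_βcl h3 ht hs⟩
    obtain ⟨q, hq, -⟩ := exists_mem_iInter_βcl_notMem h1.1 h2 (Z := ∅)
      (fun A hA h => h1.2 (Set.subset_empty_iff.1 h ▸ hA))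
    exact ⟨q, hq⟩
  simp only [Set.mem_iInter] at hpT
  have hwf : WellFounded fun G F : Pf 𝒯 => G.1 ⊂ F.1 :=
    InvImage.wf (fun F : Pf 𝒯 => F.1) wellFounded_lt
  obtain ⟨X, hX⟩ := exists_forall_of_wellFounded (X := ChainData (D := D) p C) hwf
    (fun F y x => x.a ∈ C 1 ∧ x.a ∈ (Φ F : Set S) ∧
      (∀ f ∈ F.1, blockSum x.a x.H f ∈ inS (C 1 ∩ (Φ F : Set S))) ∧
      (∀ G hG, ∀ s ∈ (y G hG).H.1, ∀ t ∈ x.H.1, s < t) ∧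
      (∀ f ∈ F.1, (F.1.card, blockSum x.a x.H f) ∈ x.W) ∧
      ∀ G hG, ∀ w ∈ (y G hG).W, ∀ f ∈ F.1, (w.1, w.2 + blockSum x.a x.H f) ∈ x.W) (by
    intro F y
    have hcard : 1 ≤ F.1.card := F.2.1.card_pos
    -- Only finitely many `G` precede `F`, so only finitely many recorded sums must be continued.
    have hfin : Finite {G : Pf 𝒯 // G.1 ⊂ F.1} := by
      refine Finite.of_injective
        (fun G => (⟨G.1.1, Finset.mem_powerset.2 G.2.subset⟩ : F.1.powerset)) fun G G' h => ?_
      exact Subtype.ext (Subtype.ext (Subtype.mk.inj h))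
    cases nonempty_fintype {G : Pf 𝒯 // G.1 ⊂ F.1}
    let W₀ : Finset (ℕ × WithZero S) :=
      Finset.univ.biUnion fun G : {G : Pf 𝒯 // G.1 ⊂ F.1} => (y G.1 G.2).W
    have hW₀ : ∀ w ∈ W₀, 1 ≤ w.1 ∧ w.2 ∈ inS (starSet p (C w.1)) := by
      intro w hw
      obtain ⟨G, -, hG⟩ := Finset.mem_biUnion.1 hw
      exact (y G.1 G.2).mem_starSet w hG
    obtain ⟨d, hd⟩ := (Finset.univ.biUnion fun G : {G : Pf 𝒯 // G.1 ⊂ F.1} =>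
      (y G.1 G.2).H.1).exists_le
    let A : Set S := (C 1 ∩ Φ F ∩ starSet p (C F.1.card)) ∩
      ⋂ w ∈ W₀, {x | w.2 + (x : WithZero S) ∈ inS (starSet p (C w.1))}
    have hA : A ∈ p := by
      refine Filter.inter_mem (Filter.inter_mem (Filter.inter_mem (hC 1 le_rfl)
        (hpT _ (Φ F).2)) (starSet_mem hp_idem (hC _ hcard)))
        ((Filter.biInter_finset_mem W₀).2 fun w hw => ?_)
      obtain ⟨-, s, hs, hsw⟩ := hW₀ w hw
      refine Filter.mem_of_superset (add_starSet_mem hp_idem hs) fun x hx => ?_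
      rw [Set.mem_ofPred_eq, ← hsw]
      exact ⟨s + x, hx, WithZero.coe_add _ _⟩
    obtain ⟨a, ha, H, hH, hsum⟩ := exists_add_sum_mem h1 h2 h3 F.1 (fun A hA d => h4 A hA d F)
      hpK hA d
    have hstep : ∀ f ∈ F.1, ∀ w ∈ W₀,
        w.2 + blockSum a H f ∈ inS (starSet p (C w.1)) := by
      intro f hf w hw
      obtain ⟨s, hs, hsf⟩ := hsum f hf
      have := Set.mem_iInter₂.1 hs.2 w hw
      rwa [blockSum, ← hsf]
    refine ⟨⟨a, H, F.1.image (fun f => (F.1.card, blockSum a H f)) ∪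
      (W₀ ×ˢ F.1).image (fun wf => (wf.1.1, wf.1.2 + blockSum a H wf.2)), ?_⟩,
      ha.1.1.1, ha.1.1.2, ?_, ?_, ?_, ?_⟩
    · intro w hw
      obtain hw | hw := Finset.mem_union.1 hw
      · obtain ⟨f, hf, rfl⟩ := Finset.mem_image.1 hw
        exact ⟨hcard, inS_mono (fun x hx => hx.1.2) (hsum f hf)⟩
      · obtain ⟨⟨w', f⟩, hwf, rfl⟩ := Finset.mem_image.1 hw
        obtain ⟨hw', hf⟩ := Finset.mem_product.1 hwf
        exact ⟨(hW₀ w' hw').1, hstep f hf w' hw'⟩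
    · exact fun f hf => inS_mono (fun x hx => hx.1.1) (hsum f hf)
    · exact fun G hG s hs t ht =>
        (hd s (Finset.mem_biUnion.2 ⟨⟨G, hG⟩, Finset.mem_univ _, hs⟩)).trans_lt (hH t ht)
    · exact fun f hf => Finset.mem_union_left _ (Finset.mem_image.2 ⟨f, hf, rfl⟩)
    · refine fun G hG w hw f hf => Finset.mem_union_right _
        (Finset.mem_image.2 ⟨(w, f), Finset.mem_product.2 ⟨?_, hf⟩, rfl⟩)
      exact Finset.mem_biUnion.2 ⟨⟨G, hG⟩, Finset.mem_univ _, hw⟩)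
  choose hXC hXΦ hXsum hXlt hXcard hXstep using hX
  refine ⟨fun F => ⟨(X F).a, hXC F⟩, fun F => (X F).H, hXΦ, hXsum, fun F G hGF => ?_, ?_⟩
  · obtain ⟨a, ha⟩ := exists_isGreatest_of_isChain_lt (X G).H.2.1 (X G).H.2.2
    obtain ⟨b, hb⟩ := exists_isLeast_of_isChain_lt (X F).H.2.1 (X F).H.2.2
    exact ⟨a, b, ha, hb, hXlt F G hGF a ha.1 b hb.1⟩
  · have hchain : ∀ (m : ℕ) (G : Fin (m + 1) → Pf 𝒯) (f : Fin (m + 1) → D → S),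
        (∀ i j, i < j → (G i).1 ⊂ (G j).1) → (∀ i, f i ∈ (G i).1) →
        ((G 0).1.card, ∑ i, blockSum (X (G i)).a (X (G i)).H (f i)) ∈ (X (G (Fin.last m))).W := by
      intro m
      induction m with
      | zero =>
        intro G f _ hf
        simpa using hXcard (G 0) (f 0) (hf 0)
      | succ m ih =>
        intro G f hG hf
        rw [Fin.sum_univ_castSucc]
        exact hXstep (G (Fin.last _)) (G (Fin.last m).castSucc)
          (hG _ _ (Fin.castSucc_lt_last _)) _
          (ih (fun i => G i.castSucc) (fun i => f i.castSucc)
            (fun i j hij => hG _ _ (Fin.castSucc_lt_castSucc_iff.2 hij)) fun i => hf _)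
          _ (hf _)
    intro m hm G f hG hf
    obtain ⟨m, rfl⟩ := Nat.exists_eq_succ_of_ne_zero hm.ne'
    exact inS_mono (fun x hx => hx.1) ((X _).mem_starSet _ (hchain m G f hG hf)).2
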